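/- Let $A$ be an arbitrary (possibly non-unital) $C^*$-algebra and let $X$ be a (right) Hilbert $A$-module, with $A$-valued inner product $\langle\cdot,\cdot\rangle$ linear in the second variable. Let $\ell^2(A)$ be the Hilbert $A$-module of all sequences $(a_n)_{n}$ in $A$ for which $\sum_n a_n^*a_n$ converges in norm, with $\langle (a_n)_n,(b_n)_n\rangle=\sum_n a_n^*b_n$. Let $M(X)=\mathbb B(A,X)$ be the multiplier module of $X$, i.e. the adjointable operators from $A$ (with $\langle a,b\rangle=a^*b$) to $X$; $X$ is regarded as a subset of $M(X)$ by identifying $x$ with $a\mapsto xa$. For $v\in M(X)$, $a\in A$ and $x\in X$ write $va=v(a)\in X$, $\langle v,x\rangle=v^*x\in A$ and $\langle x,v\rangle=\langle v,x\rangle^*$. A sequence $(v_n)_{n}$ in $M(X)$ is a frame for $X$ (if all $v_n\in X$), respectively an outer frame for $X$ (if $v_n\notin X$ for at least one $n$), when there are constants $c,C>0$ such that $$c\,\langle x,x\rangle\le\sum_{n=1}^\infty\langle x,v_n\rangle\langle v_n,x\rangle\le C\,\langle x,x\rangle\qquad\text{for all }x\in X,$$ the series converging in norm. The synthesis operator of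 $(v_n)_n$ is the adjoint $T:\ell^2(A)\to X$ of its analysis operator $U:X\to\ell^2(A)$, $Ux=(\langle v_n,x\rangle)_n$. Theorem. 1. For every adjointable surjection $T:\ell^2(A)\to X$ there is a unique sequence $(v_n)_n$ in $M(X)$ that is a frame or an outer frame for $X$ and whose synthesis operator is $T$. 2. Conversely, every frame or outer frame $(v_n)_n$ for $X$ has exactly one synthesis operator $T$; it is an adjointable surjection, and $T((a_n)_n)=\sum_{n=1}^\infty v_na_n$ for all $(a_n)_n\in\ell^2(A)$, with convergence in norm (unconditionally). Hence assigning to each sequence its synthesis operator is a bijection from the set of all frames and outer frames for $X$ onto the set of all adjointable surjections $\ell^2(A)\to X$. -/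

import Mathlib

/-!
Right Hilbert modules over a (possibly non-unital) C⋆-algebra `A` are Mathlib's Hilbert C⋆-modules
over the opposite algebra `Aᵐᵒᵖ`: the right action is `x a = MulOpposite.op a • x`, and the
`A`-valued inner product is `ModularFrame.rinner A x y`, the inner product with `op` removed.
-/

namespace ModularFrame

open MulOpposite

noncomputable section

section Defs

variable (A : Type*) [NonUnitalCStarAlgebra A] [PartialOrder A] [StarOrderedRing A]

/-- The `A`-valued inner product `⟨x, y⟩` of a right Hilbert `A`-module: it is `A`-linear in the
second variable, `⟨x, y a⟩ = ⟨x, y⟩ a`, and satisfies `⟨x, y⟩ = ⟨y, x⟩⋆`. -/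
def rinner {X : Type*} [Inner Aᵐᵒᵖ X] (x y : X) : A := unop (inner Aᵐᵒᵖ x y)

/-- `S` is the adjoint of `T`: `⟨T x, y⟩ = ⟨x, S y⟩` for all `x`, `y`. -/
def IsAdjointPair {X Y : Type*} [Inner Aᵐᵒᵖ X] [Inner Aᵐᵒᵖ Y] (T : X → Y) (S : Y → X) : Prop :=
  ∀ x y, rinner A (T x) y = rinner A x (S y)

/-- `T` is an adjointable operator. (Linearity over `ℂ` and `A`, and boundedness between complete
modules, follow from the existence of an adjoint.) -/
def IsAdjointable {X Y : Type*} [Inner Aᵐᵒᵖ X] [Inner Aᵐᵒᵖ Y] (T : X → Y) : Prop :=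
  ∃ S : Y → X, IsAdjointPair A T S

/-! ### The generalized Hilbert space `ℓ²(A)` -/

variable {A} in
theorem summable_of_nonneg_of_le {f g : ℕ → A} (hf : ∀ n, 0 ≤ f n) (hfg : ∀ n, f n ≤ g n)
    (hg : Summable g) : Summable f := by
  rw [summable_iff_vanishing_norm] at hg ⊢
  intro ε hε
  obtain ⟨s, hs⟩ := hg ε hε
  refine ⟨s, fun t ht => lt_of_le_of_lt ?_ (hs t ht)⟩
  exact CStarAlgebra.norm_le_norm_of_nonneg_of_le (Finset.sum_nonneg fun i _ => hf i)
    (Finset.sum_le_sum fun i _ => hfg i)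

/-- The sequences `(aₙ)` in `A` for which `∑ aₙ⋆ aₙ` converges in norm. The terms are positive, so
convergence and unconditional convergence are the same. -/
def ell2Submodule : Submodule ℂ (ℕ → A) where
  carrier := {a | Summable fun n => star (a n) * a n}
  zero_mem' := by simp [summable_zero]
  add_mem' {a b} ha hb := by
    refine summable_of_nonneg_of_le (fun n => star_mul_self_nonneg _) (fun n => ?_)
      ((ha.add hb).add (ha.add hb))
    have h := star_mul_self_nonneg (a n - b n)
    rw [← sub_nonneg]
    convert h using 1
    simp only [Pi.add_apply, star_add, star_sub, mul_add, add_mul, sub_mul, mul_sub]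
    abel
  smul_mem' c a ha := by
    have h : (fun n => star ((c • a) n) * (c • a) n)
        = fun n => (star c * c) • (star (a n) * a n) := by
      funext n
      simp only [Pi.smul_apply, star_smul, smul_mul_smul_comm]
    change Summable fun n => star ((c • a) n) * (c • a) n
    rw [h]
    exact ha.const_smul (star c * c)

/-- The generalized Hilbert space `ℓ²(A)`: all sequences `(aₙ)` in `A` for which `∑ aₙ⋆ aₙ`
converges in norm. -/
def Ell2 : Type _ := ell2Submodule A

namespace Ell2

instance : AddCommGroup (Ell2 A) := inferInstanceAs (AddCommGroup (ell2Submodule A))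

instance : Module ℂ (Ell2 A) := inferInstanceAs (Module ℂ (ell2Submodule A))

instance : CoeFun (Ell2 A) (fun _ => ℕ → A) := ⟨Subtype.val⟩

variable {A}

theorem ext {a b : Ell2 A} (h : ∀ n, a n = b n) : a = b := Subtype.ext (funext h)

theorem summable_self (a : Ell2 A) : Summable fun n => star (a n) * a n := a.2

theorem add_apply (a b : Ell2 A) (n : ℕ) : (a + b) n = a n + b n := rfl

theorem sub_apply (a b : Ell2 A) (n : ℕ) : (a - b) n = a n - b n := rfl

theorem smul_apply (c : ℂ) (a : Ell2 A) (n : ℕ) : (c • a) n = c • a n := rfl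

/-- The right action `(aₙ) b = (aₙ b)`. -/
instance : SMul Aᵐᵒᵖ (Ell2 A) where
  smul b a := ⟨fun n => a n * unop b, by
    have h := (a.summable_self.mul_left (star (unop b))).mul_right (unop b)
    refine h.congr fun n => ?_
    simp only [star_mul, mul_assoc]⟩

theorem op_smul_apply (b : Aᵐᵒᵖ) (a : Ell2 A) (n : ℕ) : (b • a) n = a n * unop b := rfl

theorem summable_inner (a b : Ell2 A) : Summable fun n => star (a n) * b n := by
  have h := ((((a + b).summable_self.sub (a - b).summable_self).sub
    ((a + Complex.I • b).summable_self.const_smul Complex.I)).add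
    ((a - Complex.I • b).summable_self.const_smul Complex.I)).const_smul (1 / 4 : ℂ)
  refine h.congr fun n => ?_
  simp only [add_apply, sub_apply, smul_apply, star_add, star_sub, star_smul, mul_add, add_mul,
    sub_mul, mul_sub, smul_mul_assoc, mul_smul_comm, smul_add, smul_sub, smul_smul,
    RCLike.star_def, Complex.conj_I]
  ring_nf
  simp only [Complex.I_sq, Complex.I_pow_three]
  module

instance : Norm (Ell2 A) where
  norm a := √‖∑' n, star (a n) * a n‖

/-- `ℓ²(A)` is a right Hilbert C⋆-module, with `⟨(aₙ), (bₙ)⟩ = ∑ aₙ⋆ bₙ`. -/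
instance : CStarModule Aᵐᵒᵖ (Ell2 A) where
  inner a b := op (∑' n, star (a n) * b n)
  inner_add_right {a b c} := by
    rw [← op_add, ← (summable_inner a b).tsum_add (summable_inner a c)]
    simp only [add_apply, mul_add]
  inner_self_nonneg {a} := by
    change (0 : A) ≤ ∑' n, star (a n) * a n
    exact tsum_nonneg fun n => star_mul_self_nonneg _
  inner_self {a} := by
    rw [op_eq_zero_iff]
    constructor
    · intro h
      refine ext fun n => ?_
      have h1 : star (a n) * a n ≤ ∑' n, star (a n) * a n :=
        a.summable_self.le_tsum n fun _ _ => star_mul_self_nonneg _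
      rw [h] at h1
      exact (CStarRing.star_mul_self_eq_zero_iff _).1
        (le_antisymm h1 (star_mul_self_nonneg _))
    · rintro rfl
      have h : ∀ n, (0 : Ell2 A) n = 0 := fun _ => rfl
      simp [h]
  inner_op_smul_right {b x y} := by
    apply unop_injective
    change ∑' n, star (x n) * (y n * unop b) = (∑' n, star (x n) * y n) * unop b
    rw [← (summable_inner x y).tsum_mul_right]
    simp only [mul_assoc]
  inner_smul_right_complex {z x y} := by
    rw [← op_smul, ← (summable_inner x y).tsum_const_smul]
    simp only [smul_apply, mul_smul_comm]
  star_inner x y := by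
    apply unop_injective
    change star (∑' n, star (x n) * y n) = ∑' n, star (y n) * x n
    rw [tsum_star]
    simp only [star_mul, star_star]
  norm_eq_sqrt_norm_inner_self x := rfl

theorem inner_def (a b : Ell2 A) : inner Aᵐᵒᵖ a b = op (∑' n, star (a n) * b n) := rfl

instance : NormedAddCommGroup (Ell2 A) := CStarModule.normedAddCommGroup Aᵐᵒᵖ

instance : NormedSpace ℂ (Ell2 A) := .ofCore (CStarModule.normedSpaceCore Aᵐᵒᵖ)

end Ell2

/-! ### The multiplier module `M(X)` -/

/-- The multiplier module `M(X) = 𝔹(A, X)` of a right Hilbert `A`-module `X`. An element `v` is an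
adjointable operator `a ↦ v a` from the Hilbert module `A`, with `⟨a, b⟩ = a⋆ b`, to `X`. Its
adjoint `x ↦ v⋆ x`, which `v` determines, is the restriction `x ↦ ⟨v, x⟩ ∈ A` to `X` of the
`M(A)`-valued inner product `⟨v, w⟩ = v⋆ w` of `M(X)`. -/
structure MultiplierModule (X : Type*) [Inner Aᵐᵒᵖ X] where
  /-- `v a`, the action of `a : A` on `v`, an element of `X`. -/
  act : A → X
  /-- `⟨v, x⟩`, for `x : X`. -/
  pairing : X → A
  /-- `⟨v a, x⟩ = a⋆ ⟨v, x⟩`. -/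
  adjoint : ∀ a x, rinner A (act a) x = star a * pairing x

section Frames

variable {X : Type*} [NormedAddCommGroup X] [NormedSpace ℂ X] [SMul Aᵐᵒᵖ X] [CStarModule Aᵐᵒᵖ X]

/-- The canonical embedding of `X` in `M(X)`: `x` acts as `a ↦ x a`, and `⟨x, ·⟩` is the inner
product of `X`. -/
def MultiplierModule.ofModule (x : X) : MultiplierModule A X where
  act a := op a • x
  pairing y := rinner A x y
  adjoint a y := by
    simp only [rinner]
    rw [CStarModule.inner_op_smul_left, unop_mul, ← op_star, unop_op]

/-- A frame for `X`: a sequence `(xₙ)` in `X` such that, for some constants `c, C > 0`,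
`c ⟨x, x⟩ ≤ ∑ ⟨x, xₙ⟩ ⟨xₙ, x⟩ ≤ C ⟨x, x⟩` for all `x`, with convergence in norm. The terms are
positive, so convergence and unconditional convergence are the same. -/
def IsFrame (f : ℕ → X) : Prop :=
  ∃ c C : ℝ, 0 < c ∧ 0 < C ∧ ∀ x : X, ∃ s : A,
    HasSum (fun n => rinner A x (f n) * rinner A (f n) x) s ∧
      c • rinner A x x ≤ s ∧ s ≤ C • rinner A x x

/-- An outer frame for `X`: a sequence `(vₙ)` in `M(X)`, not all of whose members are in `X`, such
that, for some constants `c, C > 0`, `c ⟨x, x⟩ ≤ ∑ ⟨x, vₙ⟩ ⟨vₙ, x⟩ ≤ C ⟨x, x⟩` for all `x` in `X`,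
with convergence in norm; here `⟨x, vₙ⟩ = ⟨vₙ, x⟩⋆`. -/
def IsOuterFrame (v : ℕ → MultiplierModule A X) : Prop :=
  (∃ n, v n ∉ Set.range (MultiplierModule.ofModule A (X := X))) ∧
    ∃ c C : ℝ, 0 < c ∧ 0 < C ∧ ∀ x : X, ∃ s : A,
      HasSum (fun n => star ((v n).pairing x) * (v n).pairing x) s ∧
        c • rinner A x x ≤ s ∧ s ≤ C • rinner A x x

/-- A sequence in `M(X)` that is a frame (that is, it comes from a frame in `X`) or an outer
frame for `X`. -/
def IsFrameOrOuterFrame (v : ℕ → MultiplierModule A X) : Prop :=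
  (∃ f : ℕ → X, IsFrame A f ∧ ∀ n, v n = MultiplierModule.ofModule A (f n)) ∨ IsOuterFrame A v

/-- `T` is the synthesis operator of `(vₙ)`: the sequence `(vₙ)` has an analysis operator
`U : X → ℓ²(A)`, `U x = (⟨vₙ, x⟩)ₙ`, and `T` is the adjoint of `U`. -/
def IsSynthesisOperator (v : ℕ → MultiplierModule A X) (T : Ell2 A → X) : Prop :=
  ∃ U : X → Ell2 A, (∀ x n, U x n = (v n).pairing x) ∧ IsAdjointPair A U T

end Frames

end Defs

end

end ModularFrame

/-! A sequence in `M(X)` is the same data as the coordinates of its analysis operator `U`, and `U`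
and `T` determine each other as adjoints. This gives both uniqueness claims. The frame sum at `x` is
`⟨U x, U x⟩`, so the frame inequalities say that `U` is bounded above and below in the order of `A`.
What remains is to match these bounds with adjointability and surjectivity of `T`.

Given a surjection `T` with adjoint `S`, the multipliers are its values on one-coordinate sequences,
and `U = S`. Banach–Steinhaus bounds `T`, hence `S`; Baire category bounds `S` below in norm.
Applying the norm bounds to all `x b` and using `le_smul_of_norm_conjugate_le` turns them into
inequalities in `A`, without a unit.

Given a frame or outer frame, the upper bound makes `∑ vₙ aₙ` converge and its sum defines the
adjoint `T` of `U`. The lower bound makes `y ↦ y - t T U y` a strict contraction for small `t > 0`,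
so `T U`, and with it `T`, is onto. Completeness is needed for `X` only, never for `ℓ²(A)`. -/

namespace ModularFrame

open MulOpposite

/-! ### From norms of conjugates to the order of `A`. -/

section Order

variable {A : Type*} [NonUnitalCStarAlgebra A] [PartialOrder A] [StarOrderedRing A]

/-- Positive elements of a C⋆-algebra are compared by the norms of their conjugates. -/
theorem le_smul_of_norm_conjugate_le {p q : A} (hp : 0 ≤ p) (hq : 0 ≤ q) {K : ℝ} (hK : 0 ≤ K)
    (h : ∀ b : A, ‖star b * p * b‖ ≤ K * ‖star b * q * b‖) : p ≤ K • q := by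
  rw [← sub_nonpos]
  set d := p - K • q with hd
  have hds : IsSelfAdjoint d :=
    (IsSelfAdjoint.of_nonneg hp).sub (IsSelfAdjoint.of_nonneg (smul_nonneg hK hq))
  by_contra hneg
  have hiff := cfcₙ_nonpos_iff (id : ℝ → ℝ) d
  rw [cfcₙ_id ℝ d] at hiff
  rw [hiff] at hneg
  push Not at hneg
  obtain ⟨t, ht, htpos⟩ := hneg
  simp only [id] at htpos
  set δ := t / 2 with hδ
  have hδpos : 0 < δ := by positivity
  -- The element `b = f(d)` lives where `d ≥ δ`, so `b d b ≥ δ b²`. It should be nonzero because `t`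
  -- lies beyond the cutoff `δ`; the conjugation hypothesis will force `b = 0`.
  set f : ℝ → ℝ := fun s => max (s - δ) 0 with hf
  have hf0 : f 0 = 0 := by simp [hf, hδpos.le]
  have hfc : Continuous f := by fun_prop
  set b := cfcₙ f d with hb
  have hbs : star b = b := (cfcₙ_predicate f d : IsSelfAdjoint b).star_eq
  have hbd : δ • (b * b) ≤ b * d * b := by
    have e1 : b * b = cfcₙ (fun s => f s * f s) d := (cfcₙ_mul f f d).symm
    have e2 : b * d * b = cfcₙ (fun s => f s * s * f s) d := by
      rw [cfcₙ_mul (fun s => f s * s) f d (by fun_prop) (by simp) (by fun_prop) hf0,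
        cfcₙ_mul f (fun s => s) d (by fun_prop) hf0, cfcₙ_id' ℝ d]
    rw [e1, e2, ← cfcₙ_smul δ (fun s => f s * f s) d (by fun_prop) (by simp [hf0])]
    refine cfcₙ_mono (fun s _ => ?_) (by fun_prop) (by fun_prop) (by simp [hf0]) (by simp)
    simp only [hf, smul_eq_mul]
    rcases le_total (s - δ) 0 with hs | hs
    · simp [max_eq_right hs]
    · rw [max_eq_left hs]
      nlinarith [mul_nonneg (mul_nonneg hs hs) hs]
  have hbq : b * q * b ≤ ‖q‖ • (b * b) := by
    have := CStarAlgebra.star_left_conjugate_le_norm_smul (a := b) (b := q)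
    rwa [hbs] at this
  have hq0 : 0 ≤ b * q * b := by simpa only [hbs] using star_left_conjugate_nonneg hq b
  have hb0 : 0 ≤ b * b := by simpa only [hbs] using star_mul_self_nonneg b
  have hbp : b * p * b = b * d * b + K • (b * q * b) := by
    rw [hd]
    simp only [mul_sub, sub_mul, mul_smul_comm, smul_mul_assoc, sub_add_cancel]
  have hle1 : δ • (b * b) ≤ b * p * b := by
    rw [hbp]
    exact hbd.trans (le_add_of_nonneg_right (smul_nonneg hK hq0))
  -- The extra `δ` is the gain: in norm, against `‖b p b‖ ≤ K ‖b q b‖`, it leaves `δ ‖b q b‖ ≤ 0`.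
  -- Then `b q b`, `b p b` and, by `hle1`, `b²` all vanish.
  have hle2 : (δ + ‖q‖ * K) • (b * q * b) ≤ ‖q‖ • (b * p * b) := by
    rw [hbp, add_smul, smul_add, smul_smul]
    refine add_le_add_left ?_ _
    calc δ • (b * q * b) ≤ δ • ‖q‖ • (b * b) := smul_le_smul_of_nonneg_left hbq hδpos.le
      _ = ‖q‖ • δ • (b * b) := smul_comm _ _ _
      _ ≤ ‖q‖ • (b * d * b) := smul_le_smul_of_nonneg_left hbd (norm_nonneg q)
  have hnorm := h b
  rw [hbs] at hnorm
  have hcoef : 0 ≤ δ + ‖q‖ * K := by positivity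
  have hn2 := CStarAlgebra.norm_le_norm_of_nonneg_of_le (smul_nonneg hcoef hq0) hle2
  rw [norm_smul, norm_smul, Real.norm_of_nonneg hcoef, norm_norm] at hn2
  have hbqb : ‖b * q * b‖ = 0 := by
    have := mul_le_mul_of_nonneg_left hnorm (norm_nonneg q)
    nlinarith [norm_nonneg (b * q * b)]
  have hn1 := CStarAlgebra.norm_le_norm_of_nonneg_of_le (smul_nonneg hδpos.le hb0) hle1
  rw [norm_smul, Real.norm_of_nonneg hδpos.le] at hn1
  rw [hbqb, mul_zero] at hnorm
  have hbb : ‖star b * b‖ = 0 := by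
    rw [hbs]
    nlinarith [norm_nonneg (b * b)]
  have hbz : b = 0 := (CStarRing.star_mul_self_eq_zero_iff b).1 (norm_eq_zero.1 hbb)
  -- Vanishing of `f(d)` makes `f` zero on the quasispectrum of `d`, whereas `f t = t / 2 > 0`.
  have hft : f t = 0 := by
    have he : cfcₙ f d = cfcₙ (fun _ => (0 : ℝ)) d := by rw [← hb, hbz, cfcₙ_const_zero]
    exact eqOn_of_cfcₙ_eq_cfcₙ he (ha := hds) (hf := hfc.continuousOn) (hf0 := hf0)
      (hg := continuousOn_const) (hg0 := rfl) ht
  have := le_max_left (t - δ) 0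
  simp only [hf] at hft
  linarith

end Order

/-! ### Inner product calculus and adjoint pairs. -/

section Inner

variable {A : Type*} [NonUnitalCStarAlgebra A] [PartialOrder A]
variable {X : Type*} [NormedAddCommGroup X] [NormedSpace ℂ X] [SMul Aᵐᵒᵖ X] [CStarModule Aᵐᵒᵖ X]
variable {Y : Type*} [NormedAddCommGroup Y] [NormedSpace ℂ Y] [SMul Aᵐᵒᵖ Y] [CStarModule Aᵐᵒᵖ Y]

theorem star_rinner (x y : X) : star (rinner A x y) = rinner A y x := by
  rw [rinner, ← unop_star, CStarModule.star_inner, rinner]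

theorem rinner_add_left (x y z : X) : rinner A (x + y) z = rinner A x z + rinner A y z := by
  simp [rinner]

theorem rinner_add_right (x y z : X) : rinner A x (y + z) = rinner A x y + rinner A x z := by
  simp [rinner]

theorem rinner_sub_left (x y z : X) : rinner A (x - y) z = rinner A x z - rinner A y z := by
  simp [rinner]

theorem rinner_sub_right (x y z : X) : rinner A x (y - z) = rinner A x y - rinner A x z := by
  simp [rinner]

theorem rinner_smul_left (c : ℂ) (x y : X) : rinner A (c • x) y = star c • rinner A x y := by
  simp [rinner]

theorem rinner_smul_right (c : ℂ) (x y : X) : rinner A x (c • y) = c • rinner A x y := by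
  simp [rinner]

theorem rinner_op_smul_left (b : A) (x y : X) :
    rinner A (op b • x) y = star b * rinner A x y := by
  simp [rinner, ← op_star]

theorem rinner_op_smul_right (b : A) (x y : X) :
    rinner A x (op b • y) = rinner A x y * b := by
  simp [rinner]

theorem rinner_sum_left {ι : Type*} (s : Finset ι) (x : ι → X) (y : X) :
    rinner A (∑ i ∈ s, x i) y = ∑ i ∈ s, rinner A (x i) y := by
  simp [rinner, Finset.unop_sum]

theorem rinner_self_nonneg (x : X) : 0 ≤ rinner A x x :=
  CStarModule.inner_self_nonneg (A := Aᵐᵒᵖ) (x := x)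

theorem norm_sq_eq_norm_rinner (x : X) : ‖x‖ ^ 2 = ‖rinner A x x‖ :=
  CStarModule.norm_sq_eq Aᵐᵒᵖ

theorem ext_rinner {x y : X} (h : ∀ z, rinner A x z = rinner A y z) : x = y := by
  rw [← sub_eq_zero, ← CStarModule.inner_self (A := Aᵐᵒᵖ)]
  apply unop_injective
  change rinner A (x - y) (x - y) = 0
  rw [rinner_sub_left, h, sub_self]

namespace IsAdjointPair

theorem symm {T : X → Y} {S : Y → X} (h : IsAdjointPair A T S) : IsAdjointPair A S T := by
  intro y x
  rw [← star_rinner, ← h, star_rinner]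

theorem unique_left {T T' : X → Y} {S : Y → X} (h : IsAdjointPair A T S)
    (h' : IsAdjointPair A T' S) : T = T' :=
  funext fun x => ext_rinner (A := A) fun y => by rw [h, h']

theorem unique_right {T : X → Y} {S S' : Y → X} (h : IsAdjointPair A T S)
    (h' : IsAdjointPair A T S') : S = S' :=
  h.symm.unique_left h'.symm

theorem map_add {T : X → Y} {S : Y → X} (h : IsAdjointPair A T S) (x y : X) :
    T (x + y) = T x + T y :=
  ext_rinner (A := A) fun z => by rw [h, rinner_add_left, rinner_add_left, h, h]

theorem map_sub {T : X → Y} {S : Y → X} (h : IsAdjointPair A T S) (x y : X) :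
    T (x - y) = T x - T y :=
  ext_rinner (A := A) fun z => by rw [h, rinner_sub_left, rinner_sub_left, h, h]

theorem map_smul {T : X → Y} {S : Y → X} (h : IsAdjointPair A T S) (c : ℂ) (x : X) :
    T (c • x) = c • T x :=
  ext_rinner (A := A) fun z => by rw [h, rinner_smul_left, rinner_smul_left, h]

theorem map_op_smul {T : X → Y} {S : Y → X} (h : IsAdjointPair A T S) (b : A) (x : X) :
    T (op b • x) = op b • T x :=
  ext_rinner (A := A) fun z => by rw [h, rinner_op_smul_left, rinner_op_smul_left, h]

/-- An adjointable operator as a linear map. -/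
def toLinearMap {T : X → Y} {S : Y → X} (h : IsAdjointPair A T S) : X →ₗ[ℂ] Y where
  toFun := T
  map_add' := h.map_add
  map_smul' := h.map_smul

end IsAdjointPair

namespace MultiplierModule

theorem ext_pairing {v w : MultiplierModule A X} (h : ∀ x, v.pairing x = w.pairing x) :
    v = w := by
  obtain ⟨f, p, hv⟩ := v
  obtain ⟨g, q, hw⟩ := w
  obtain rfl : p = q := funext h
  obtain rfl : f = g := funext fun a => ext_rinner (A := A) fun x => by rw [hv, hw]
  rfl

end MultiplierModule

/-- The sequences in `M(X)` that satisfy the two frame inequalities. -/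
theorem isFrameOrOuterFrame_iff (v : ℕ → MultiplierModule A X) :
    IsFrameOrOuterFrame A v ↔ ∃ c C : ℝ, 0 < c ∧ 0 < C ∧ ∀ x : X, ∃ s : A,
      HasSum (fun n => star ((v n).pairing x) * (v n).pairing x) s ∧
        c • rinner A x x ≤ s ∧ s ≤ C • rinner A x x := by
  constructor
  · rintro (⟨f, hf, hv⟩ | hv)
    · simpa only [IsFrame, ← star_rinner (f _), hv, MultiplierModule.ofModule] using hf
    · exact hv.2
  · intro hv
    by_cases hr : ∃ n, v n ∉ Set.range (MultiplierModule.ofModule A (X := X))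
    · exact Or.inr ⟨hr, hv⟩
    · push Not at hr
      choose f hf using hr
      refine Or.inl ⟨f, ?_, fun n => (hf n).symm⟩
      simpa only [IsFrame, ← star_rinner (f _), ← hf, MultiplierModule.ofModule] using hv

variable [StarOrderedRing A]

theorem norm_rinner_le (x y : X) : ‖rinner A x y‖ ≤ ‖x‖ * ‖y‖ :=
  CStarModule.norm_inner_le (A := Aᵐᵒᵖ) X

theorem continuous_rinner_left (y : X) : Continuous fun x : X => rinner A x y :=
  continuous_unop.comp
    ((CStarModule.continuous_inner (A := Aᵐᵒᵖ)).comp (Continuous.prodMk_left y))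

/-- If `‖x b‖ ≤ M ‖y b‖` for all `b` in `A`, then `⟨x, x⟩ ≤ M² ⟨y, y⟩`. -/
theorem rinner_self_le_of_norm_op_smul_le {x : X} {y : Y} {M : ℝ}
    (h : ∀ b : A, ‖op b • x‖ ≤ M * ‖op b • y‖) :
    rinner A x x ≤ M ^ 2 • rinner A y y := by
  refine le_smul_of_norm_conjugate_le (rinner_self_nonneg x) (rinner_self_nonneg y)
    (sq_nonneg M) fun b => ?_
  have hx : ‖op b • x‖ ^ 2 = ‖star b * rinner A x x * b‖ := by
    rw [norm_sq_eq_norm_rinner (A := A), rinner_op_smul_right, rinner_op_smul_left]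
  have hy : ‖op b • y‖ ^ 2 = ‖star b * rinner A y y * b‖ := by
    rw [norm_sq_eq_norm_rinner (A := A), rinner_op_smul_right, rinner_op_smul_left]
  rw [← hx, ← hy, ← mul_pow]
  exact pow_le_pow_left₀ (norm_nonneg _) (h b) 2

theorem norm_sq_le_of_rinner_self_le {x : X} {y : Y} {M : ℝ} (hM : 0 ≤ M)
    (h : rinner A x x ≤ M • rinner A y y) : ‖x‖ ^ 2 ≤ M * ‖y‖ ^ 2 := by
  have := CStarAlgebra.norm_le_norm_of_nonneg_of_le (rinner_self_nonneg x) h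
  rwa [norm_smul, Real.norm_of_nonneg hM, ← norm_sq_eq_norm_rinner, ← norm_sq_eq_norm_rinner]
    at this

/-! ### Boundedness, lower bounds and surjectivity of adjointable operators. -/

namespace IsAdjointPair

/-- A bound for an operator is a bound for its adjoint. -/
theorem norm_adjoint_le {T : X → Y} {S : Y → X} (h : IsAdjointPair A T S) {M : ℝ} (hM0 : 0 ≤ M)
    (hM : ∀ x, ‖T x‖ ≤ M * ‖x‖) (y : Y) : ‖S y‖ ≤ M * ‖y‖ := by
  rcases (norm_nonneg (S y)).eq_or_lt with h0 | h0
  · rw [← h0]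
    positivity
  · have h1 : ‖S y‖ ^ 2 ≤ M * ‖S y‖ * ‖y‖ := by
      rw [norm_sq_eq_norm_rinner (A := A), ← h]
      exact (norm_rinner_le _ _).trans (mul_le_mul_of_nonneg_right (hM _) (norm_nonneg y))
    nlinarith

/-- An operator whose adjoint is everywhere defined on a complete module is bounded. -/
theorem exists_norm_le [CompleteSpace Y] {T : X → Y} {S : Y → X} (h : IsAdjointPair A T S) :
    ∃ M, 0 ≤ M ∧ ∀ x, ‖T x‖ ≤ M * ‖x‖ := by
  -- Uniform boundedness is applied to `y ↦ ⟨T x, y⟩` over the unit ball; the adjoint gives the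
  -- pointwise bound `‖S y‖`. Evaluating at `y = T x` then recovers `‖T x‖`.
  let g : {x : X // ‖x‖ ≤ 1} → Y →L[ℂ] A := fun x =>
    LinearMap.mkContinuous
      { toFun := fun y => rinner A (T x) y
        map_add' := fun y z => rinner_add_right _ y z
        map_smul' := fun c y => rinner_smul_right c _ y } ‖T x‖ fun y => norm_rinner_le _ _
  have hg : ∀ x y, g x y = rinner A (T x) y := fun _ _ => rfl
  obtain ⟨M, hM⟩ := banach_steinhaus (g := g) fun y => ⟨‖S y‖, fun x => by
    rw [hg, h]
    exact (norm_rinner_le _ _).trans (mul_le_of_le_one_left (norm_nonneg _) x.2)⟩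
  have hM0 : 0 ≤ M := (norm_nonneg _).trans (hM ⟨0, by simp⟩)
  have hball : ∀ x : X, ‖x‖ ≤ 1 → ‖T x‖ ≤ M := fun x hx => by
    have h1 : ‖T x‖ ^ 2 ≤ M * ‖T x‖ := by
      rw [norm_sq_eq_norm_rinner (A := A), ← hg ⟨x, hx⟩]
      exact (g ⟨x, hx⟩).le_of_opNorm_le (hM _) _
    rcases (norm_nonneg (T x)).eq_or_lt with h0 | h0
    · rwa [← h0]
    · nlinarith
  refine ⟨M, hM0, fun x => ?_⟩
  rcases eq_or_ne x 0 with rfl | hx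
  · have := h.map_sub 0 0
    rw [sub_self, sub_self] at this
    simp [this]
  · have hx' : 0 < ‖x‖ := norm_pos_iff.2 hx
    have h1 := hball (((‖x‖⁻¹ : ℝ) : ℂ) • x) (by
      rw [norm_smul, Complex.norm_real, norm_inv, norm_norm, inv_mul_cancel₀ hx'.ne'])
    rw [h.map_smul, norm_smul, Complex.norm_real, norm_inv, norm_norm, inv_mul_le_iff₀ hx'] at h1
    rwa [mul_comm]

/-- The operator inequality `⟨T x, T x⟩ ≤ M² ⟨x, x⟩` for `T` of norm at most `M`. -/
theorem rinner_self_le {T : X → Y} {S : Y → X} (h : IsAdjointPair A T S) {M : ℝ}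
    (hM : ∀ x, ‖T x‖ ≤ M * ‖x‖) (x : X) :
    rinner A (T x) (T x) ≤ M ^ 2 • rinner A x x :=
  rinner_self_le_of_norm_op_smul_le fun b => by
    rw [← h.map_op_smul]
    exact hM _

/-- The adjoint of a surjection onto a complete module is bounded below. -/
theorem exists_norm_le_adjoint_of_surjective [CompleteSpace Y] {T : X → Y} {S : Y → X}
    (h : IsAdjointPair A T S) (hT : Function.Surjective T) :
    ∃ K, 0 ≤ K ∧ ∀ y, ‖y‖ ≤ K * ‖S y‖ := by
  obtain ⟨M, -, hM⟩ := h.exists_norm_le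
  let f : X →L[ℂ] Y := h.toLinearMap.mkContinuous M hM
  have hf : ∀ x, f x = T x := fun _ => rfl
  -- Approximate preimages, with error at most `‖y‖ / 2`, need only the target to be complete. The
  -- error is absorbed into the left side of `h1`, which doubles the constant.
  obtain ⟨K, hK, hK'⟩ := f.exists_approx_preimage_norm_le hT
  refine ⟨2 * K, by positivity, fun y => ?_⟩
  obtain ⟨x, hx, hxK⟩ := hK' y
  rw [hf, dist_eq_norm, norm_sub_rev] at hx
  have h1 : ‖y‖ ^ 2 ≤ 1 / 2 * ‖y‖ * ‖y‖ + K * ‖y‖ * ‖S y‖ := by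
    have e : rinner A y y = rinner A (y - T x) y + rinner A x (S y) := by
      rw [rinner_sub_left, h, sub_add_cancel]
    rw [norm_sq_eq_norm_rinner (A := A), e]
    refine (norm_add_le _ _).trans (add_le_add ?_ ?_)
    · exact (norm_rinner_le _ _).trans (mul_le_mul_of_nonneg_right hx (norm_nonneg _))
    · exact (norm_rinner_le _ _).trans (mul_le_mul_of_nonneg_right hxK (norm_nonneg _))
  rcases (norm_nonneg y).eq_or_lt with h0 | h0
  · rw [← h0]
    positivity
  · nlinarith

/-- An adjointable operator whose adjoint `U` satisfies `c ⟨y, y⟩ ≤ ⟨U y, U y⟩` is surjective. -/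
theorem surjective_of_le_rinner_adjoint [CompleteSpace Y] {U : Y → X} {T : X → Y}
    (h : IsAdjointPair A U T) {c : ℝ} (hc : 0 < c)
    (hU : ∀ y, c • rinner A y y ≤ rinner A (U y) (U y)) : Function.Surjective T := by
  obtain ⟨M₀, hM₀, hT₀⟩ := h.symm.exists_norm_le
  -- The padding makes `M` positive and `c < M²`, so that `r = 1 - c / M²` lies strictly between 0
  -- and 1.
  set M := M₀ + c + 1 with hMdef
  have hM : 0 < M := by positivity
  have hT : ∀ x, ‖T x‖ ≤ M * ‖x‖ := fun x =>
    (hT₀ x).trans (mul_le_mul_of_nonneg_right (by linarith) (norm_nonneg x))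
  have hcM : c < M ^ 2 := by nlinarith
  set t : ℝ := (M ^ 2)⁻¹ with ht
  have ht0 : 0 < t := by positivity
  have htM : t * M ^ 2 = 1 := inv_mul_cancel₀ (by positivity)
  set r : ℝ := 1 - t * c with hr
  have hr0 : 0 ≤ r := by nlinarith
  have hr1 : r < 1 := by nlinarith [mul_pos ht0 hc]
  -- Since `t M² = 1`, the quadratic term `t² ⟨T U y, T U y⟩` is at most `t ⟨U y, U y⟩`, half of the
  -- cross term. The other half supplies the decrease `t c ⟨y, y⟩`.
  have key : ∀ y, ‖y - (t : ℂ) • T (U y)‖ ^ 2 ≤ r * ‖y‖ ^ 2 := fun y => by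
    refine norm_sq_le_of_rinner_self_le (A := A) hr0 ?_
    have e1 : rinner A y (T (U y)) = rinner A (U y) (U y) := (h _ _).symm
    have e2 : rinner A (T (U y)) y = rinner A (U y) (U y) := h.symm _ _
    have e : rinner A (y - (t : ℂ) • T (U y)) (y - (t : ℂ) • T (U y))
        = rinner A y y - (2 * t) • rinner A (U y) (U y)
          + (t * t) • rinner A (T (U y)) (T (U y)) := by
      simp only [rinner_sub_left, rinner_sub_right, rinner_smul_left, rinner_smul_right, e1, e2,
        RCLike.star_def, Complex.conj_ofReal]
      simp only [Complex.coe_smul]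
      module
    have hTU := smul_le_smul_of_nonneg_left (h.symm.rinner_self_le hT (U y))
      (mul_nonneg ht0.le ht0.le)
    have hUy := smul_le_smul_of_nonneg_left (hU y) ht0.le
    rw [smul_smul, show t * t * M ^ 2 = t by rw [mul_assoc, htM, mul_one]] at hTU
    calc _ ≤ rinner A y y - (2 * t) • rinner A (U y) (U y) + t • rinner A (U y) (U y) := by
          rw [e]
          gcongr
      _ = rinner A y y - t • rinner A (U y) (U y) := by module
      _ ≤ rinner A y y - t • c • rinner A y y := by gcongr
      _ = r • rinner A y y := by rw [hr]; module
  intro z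
  -- A fixed point of `φ` is a solution of `T (U y) = z`.
  let φ : Y → Y := fun y => y - (t : ℂ) • T (U y) + (t : ℂ) • z
  have hφ : ContractingWith (Real.toNNReal √r) φ := by
    refine ⟨?_, LipschitzWith.of_dist_le_mul fun y y' => ?_⟩
    · rw [← NNReal.coe_lt_coe, Real.coe_toNNReal _ (Real.sqrt_nonneg r), NNReal.coe_one]
      exact (Real.sqrt_lt' one_pos).2 (by simpa using hr1)
    · rw [Real.coe_toNNReal _ (Real.sqrt_nonneg r), dist_eq_norm, dist_eq_norm]
      have e : φ y - φ y' = (y - y') - (t : ℂ) • T (U (y - y')) := by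
        simp only [φ]
        rw [h.map_sub, h.symm.map_sub]
        module
      rw [e]
      refine le_of_sq_le_sq ?_ (by positivity)
      rw [mul_pow, Real.sq_sqrt hr0]
      exact key _
  refine ⟨U hφ.fixedPoint, ?_⟩
  have hfix : hφ.fixedPoint - (t : ℂ) • T (U hφ.fixedPoint) + (t : ℂ) • z = hφ.fixedPoint :=
    hφ.fixedPoint_isFixedPt
  have h1 : (t : ℂ) • T (U hφ.fixedPoint) = (t : ℂ) • z := by
    rw [sub_add, sub_eq_self, sub_eq_zero] at hfix
    exact hfix
  exact smul_right_injective Y (Complex.ofReal_ne_zero.2 ht0.ne') h1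

end IsAdjointPair

end Inner

/-! ### Analysis and synthesis operators of sequences in `M(X)`. -/

section Frames

variable {A : Type*} [NonUnitalCStarAlgebra A] [PartialOrder A] [StarOrderedRing A]

namespace Ell2

theorem rinner_eq_tsum (a b : Ell2 A) : rinner A a b = ∑' n, star (a n) * b n := rfl

open Classical in
/-- The sequence `a` cut off outside the finite set `s`. -/
noncomputable def truncate (s : Finset ℕ) (a : ℕ → A) : Ell2 A :=
  ⟨fun n => if n ∈ s then a n else 0,
    summable_of_ne_finset_zero (s := s) fun n hn => by simp [hn]⟩

theorem truncate_apply_of_mem {s : Finset ℕ} {n : ℕ} (hn : n ∈ s) (a : ℕ → A) :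
    truncate s a n = a n :=
  if_pos hn

theorem truncate_apply_of_notMem {s : Finset ℕ} {n : ℕ} (hn : n ∉ s) (a : ℕ → A) :
    truncate s a n = 0 :=
  if_neg hn

theorem rinner_truncate (s : Finset ℕ) (a : ℕ → A) (b : Ell2 A) :
    rinner A (truncate s a) b = ∑ n ∈ s, star (a n) * b n := by
  rw [rinner_eq_tsum, tsum_eq_sum (s := s) fun n hn => by
    rw [truncate_apply_of_notMem hn, star_zero, zero_mul]]
  exact Finset.sum_congr rfl fun n hn => by rw [truncate_apply_of_mem hn]

theorem norm_sq_truncate (s : Finset ℕ) (a : ℕ → A) :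
    ‖truncate s a‖ ^ 2 = ‖∑ n ∈ s, star (a n) * a n‖ := by
  rw [norm_sq_eq_norm_rinner (A := A), rinner_truncate]
  congr 1
  exact Finset.sum_congr rfl fun n hn => by rw [truncate_apply_of_mem hn]

end Ell2

variable {X : Type*} [NormedAddCommGroup X] [NormedSpace ℂ X] [SMul Aᵐᵒᵖ X] [CStarModule Aᵐᵒᵖ X]

namespace IsSynthesisOperator

theorem unique {v : ℕ → MultiplierModule A X} {T T' : Ell2 A → X}
    (h : IsSynthesisOperator A v T) (h' : IsSynthesisOperator A v T') : T = T' := by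
  obtain ⟨U, hU, hUT⟩ := h
  obtain ⟨U', hU', hUT'⟩ := h'
  obtain rfl : U = U' := funext fun x => Ell2.ext fun n => by rw [hU, hU']
  exact hUT.unique_right hUT'

theorem unique_sequence {v w : ℕ → MultiplierModule A X} {T : Ell2 A → X}
    (h : IsSynthesisOperator A v T) (h' : IsSynthesisOperator A w T) : v = w := by
  obtain ⟨U, hU, hUT⟩ := h
  obtain ⟨U', hU', hUT'⟩ := h'
  obtain rfl : U = U' := hUT.unique_left hUT'
  exact funext fun n => MultiplierModule.ext_pairing fun x => by rw [← hU, ← hU']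

end IsSynthesisOperator

/-- The sequence `(vₙ)` with `vₙ a = T (0, …, 0, a, 0, …)` of an operator `T` on `ℓ²(A)`. -/
noncomputable def multipliersOf {T : Ell2 A → X} {S : X → Ell2 A} (h : IsAdjointPair A T S)
    (n : ℕ) : MultiplierModule A X where
  act a := T (Ell2.truncate {n} fun _ => a)
  pairing x := S x n
  adjoint a x := by rw [h, Ell2.rinner_truncate, Finset.sum_singleton]

theorem isSynthesisOperator_multipliersOf {T : Ell2 A → X} {S : X → Ell2 A}
    (h : IsAdjointPair A T S) : IsSynthesisOperator A (multipliersOf h) T :=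
  ⟨S, fun _ _ => rfl, h.symm⟩

/-- The frame sum is `⟨S x, S x⟩`: its upper bound comes from boundedness of `S`, its lower bound
from surjectivity of `T`. -/
theorem isFrameOrOuterFrame_multipliersOf [CompleteSpace X] {T : Ell2 A → X} {S : X → Ell2 A}
    (h : IsAdjointPair A T S) (hT : Function.Surjective T) :
    IsFrameOrOuterFrame A (multipliersOf h) := by
  rw [isFrameOrOuterFrame_iff]
  obtain ⟨M, hM0, hM⟩ := h.exists_norm_le
  obtain ⟨K, hK0, hK⟩ := h.exists_norm_le_adjoint_of_surjective hT
  -- `K` and `M` may be zero, so 1 is added to keep the frame constants positive.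
  refine ⟨((K + 1) ^ 2)⁻¹, (M + 1) ^ 2, by positivity, by positivity, fun x =>
    ⟨rinner A (S x) (S x), (S x).summable_self.hasSum, ?_, ?_⟩⟩
  · rw [inv_smul_le_iff_of_pos (by positivity)]
    refine rinner_self_le_of_norm_op_smul_le fun b => ?_
    rw [← h.symm.map_op_smul]
    exact (hK _).trans (mul_le_mul_of_nonneg_right (by linarith) (norm_nonneg _))
  · exact h.symm.rinner_self_le (fun x => (h.norm_adjoint_le hM0 hM x).trans
      (mul_le_mul_of_nonneg_right (by linarith) (norm_nonneg _))) x

/-- If the analysis operator of `(vₙ)` is bounded, then `∑ vₙ aₙ` converges for `(aₙ)` in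
`ℓ²(A)`. -/
theorem summable_act [CompleteSpace X] {v : ℕ → MultiplierModule A X} {U : X → Ell2 A}
    (hU : ∀ x n, U x n = (v n).pairing x) {M : ℝ} (hM0 : 0 < M) (hM : ∀ x, ‖U x‖ ≤ M * ‖x‖)
    (a : Ell2 A) : Summable fun n => (v n).act (a n) := by
  -- Pairing the partial sum `y` with itself moves the multipliers onto `U y`, after which
  -- Cauchy–Schwarz and the bound on `U` apply.
  have key : ∀ s : Finset ℕ, ‖∑ n ∈ s, (v n).act (a n)‖ ≤ M * ‖Ell2.truncate s a‖ := fun s => by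
    set y := ∑ n ∈ s, (v n).act (a n) with hy
    have e : rinner A y y = rinner A (Ell2.truncate s a) (U y) := by
      rw [Ell2.rinner_truncate]
      nth_rw 1 [hy]
      rw [rinner_sum_left]
      exact Finset.sum_congr rfl fun n _ => by rw [(v n).adjoint, hU]
    have h1 : ‖y‖ ^ 2 ≤ ‖Ell2.truncate s a‖ * (M * ‖y‖) := by
      rw [norm_sq_eq_norm_rinner (A := A), e]
      exact (norm_rinner_le _ _).trans (mul_le_mul_of_nonneg_left (hM y) (norm_nonneg _))
    rcases (norm_nonneg y).eq_or_lt with h0 | h0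
    · rw [← h0]
      positivity
    · nlinarith
  rw [summable_iff_vanishing_norm]
  intro ε hε
  obtain ⟨s, hs⟩ := summable_iff_vanishing_norm.1 a.summable_self ((ε / M) ^ 2) (by positivity)
  refine ⟨s, fun t ht => (key t).trans_lt ?_⟩
  have h1 := hs t ht
  rw [← Ell2.norm_sq_truncate] at h1
  rw [← lt_div_iff₀' hM0]
  exact lt_of_pow_lt_pow_left₀ 2 (by positivity) h1

/-- Pairing with a fixed `x` is additive and continuous, so the adjoint relation of each multiplier
can be summed term by term. -/
theorem isAdjointPair_of_hasSum {v : ℕ → MultiplierModule A X} {U : X → Ell2 A} {T : Ell2 A → X}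
    (hU : ∀ x n, U x n = (v n).pairing x)
    (hT : ∀ a : Ell2 A, HasSum (fun n => (v n).act (a n)) (T a)) : IsAdjointPair A T U := by
  intro a x
  have h := (hT a).map
    (AddMonoidHom.mk' (fun y : X => rinner A y x) fun y z => rinner_add_left y z x)
    (continuous_rinner_left x)
  refine (h.tsum_eq.symm.trans ?_)
  rw [Ell2.rinner_eq_tsum]
  exact tsum_congr fun n => by
    rw [hU]
    exact (v n).adjoint _ _

/-- A frame or outer frame has a synthesis operator, which is an adjointable surjection and is
given by a norm-convergent series. -/
theorem IsFrameOrOuterFrame.exists_isSynthesisOperator [CompleteSpace X]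
    {v : ℕ → MultiplierModule A X} (h : IsFrameOrOuterFrame A v) :
    ∃ T : Ell2 A → X, IsSynthesisOperator A v T ∧ IsAdjointable A T ∧ Function.Surjective T ∧
      ∀ a : Ell2 A, HasSum (fun n => (v n).act (a n)) (T a) := by
  rw [isFrameOrOuterFrame_iff] at h
  obtain ⟨c, C, hc, hC, hv⟩ := h
  let U : X → Ell2 A := fun x => ⟨fun n => (v n).pairing x, (hv x).choose_spec.1.summable⟩
  have hU : ∀ x n, U x n = (v n).pairing x := fun _ _ => rfl
  have hUU : ∀ x, c • rinner A x x ≤ rinner A (U x) (U x) ∧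
      rinner A (U x) (U x) ≤ C • rinner A x x := fun x => by
    obtain ⟨s, hs, h1, h2⟩ := hv x
    obtain rfl : rinner A (U x) (U x) = s := hs.tsum_eq
    exact ⟨h1, h2⟩
  have hM : ∀ x, ‖U x‖ ≤ √C * ‖x‖ := fun x => by
    refine le_of_sq_le_sq ?_ (by positivity)
    rw [mul_pow, Real.sq_sqrt hC.le]
    exact norm_sq_le_of_rinner_self_le hC.le (hUU x).2
  have hT : ∀ a : Ell2 A, HasSum (fun n => (v n).act (a n)) (∑' n, (v n).act (a n)) := fun a =>
    (summable_act hU (Real.sqrt_pos.2 hC) hM a).hasSum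
  have hTU : IsAdjointPair A (fun a : Ell2 A => ∑' n, (v n).act (a n)) U :=
    isAdjointPair_of_hasSum hU hT
  exact ⟨_, ⟨U, hU, hTU.symm⟩, ⟨U, hTU⟩,
    hTU.symm.surjective_of_le_rinner_adjoint hc fun x => (hUU x).1, hT⟩

end Frames

end ModularFrame

open ModularFrame in
theorem theorem3p16 {A : Type*} [NonUnitalCStarAlgebra A] [PartialOrder A] [StarOrderedRing A]
    {X : Type*} [NormedAddCommGroup X] [NormedSpace ℂ X] [SMul Aᵐᵒᵖ X] [CStarModule Aᵐᵒᵖ X]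
    [CompleteSpace X] :
    -- every adjointable surjection is the synthesis operator of a unique frame or outer frame
    (∀ T : Ell2 A → X, IsAdjointable A T → Function.Surjective T →
      ∃! v : ℕ → MultiplierModule A X, IsFrameOrOuterFrame A v ∧ IsSynthesisOperator A v T) ∧
    -- every frame or outer frame has exactly one synthesis operator, which is an adjointable
    -- surjection and is given by a norm-convergent series
    (∀ v : ℕ → MultiplierModule A X, IsFrameOrOuterFrame A v →
      (∃! T : Ell2 A → X, IsSynthesisOperator A v T) ∧
      ∀ T : Ell2 A → X, IsSynthesisOperator A v T →
        IsAdjointable A T ∧ Function.Surjective T ∧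
          ∀ a : Ell2 A, HasSum (fun n => (v n).act (a n)) (T a)) ∧
    -- hence the synthesis operator gives a bijection
    (∃ e : {v : ℕ → MultiplierModule A X // IsFrameOrOuterFrame A v} ≃
        {T : Ell2 A → X // IsAdjointable A T ∧ Function.Surjective T},
      ∀ v T, e v = T ↔ IsSynthesisOperator A v.1 T.1) := by
  have h1 : ∀ T : Ell2 A → X, IsAdjointable A T → Function.Surjective T →
      ∃! v : ℕ → MultiplierModule A X, IsFrameOrOuterFrame A v ∧ IsSynthesisOperator A v T := by
    rintro T ⟨S, h⟩ hT
    exact ⟨multipliersOf h,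
      ⟨isFrameOrOuterFrame_multipliersOf h hT, isSynthesisOperator_multipliersOf h⟩,
      fun w hw => hw.2.unique_sequence (isSynthesisOperator_multipliersOf h)⟩
  have h2 : ∀ v : ℕ → MultiplierModule A X, IsFrameOrOuterFrame A v →
      (∃! T : Ell2 A → X, IsSynthesisOperator A v T) ∧
      ∀ T : Ell2 A → X, IsSynthesisOperator A v T →
        IsAdjointable A T ∧ Function.Surjective T ∧
          ∀ a : Ell2 A, HasSum (fun n => (v n).act (a n)) (T a) := by
    intro v hv
    obtain ⟨T, hT, h⟩ := hv.exists_isSynthesisOperator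
    refine ⟨⟨T, hT, fun T' hT' => hT'.unique hT⟩, fun T' hT' => ?_⟩
    obtain rfl := hT'.unique hT
    exact h
  refine ⟨h1, h2, ?_⟩
  choose F hF using fun v : {v : ℕ → MultiplierModule A X // IsFrameOrOuterFrame A v} =>
    (h2 v.1 v.2).1.exists
  let e : {v : ℕ → MultiplierModule A X // IsFrameOrOuterFrame A v} →
      {T : Ell2 A → X // IsAdjointable A T ∧ Function.Surjective T} := fun v =>
    ⟨F v, ((h2 v.1 v.2).2 _ (hF v)).1, ((h2 v.1 v.2).2 _ (hF v)).2.1⟩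
  have he : ∀ v T, e v = T ↔ IsSynthesisOperator A v.1 T.1 := fun v T =>
    ⟨fun h => h ▸ hF v, fun h => Subtype.ext ((hF v).unique h)⟩
  have hbij : Function.Bijective e := by
    refine ⟨fun v w hvw => Subtype.ext ?_, fun T => ?_⟩
    · exact ((he v (e w)).1 hvw).unique_sequence (hF w)
    · obtain ⟨v, ⟨hv, hvT⟩, -⟩ := h1 T.1 T.2.1 T.2.2
      exact ⟨⟨v, hv⟩, (he _ _).2 hvT⟩
  exact ⟨Equiv.ofBijective e hbij, he⟩
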